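/- Let $\widehat{\mathbb C}=\mathbb C\cup\{\infty\}$, let $n\ge 2$ be an integer, and let $\alpha\subseteq\widehat{\mathbb C}$ be a finite set with $|\alpha|\ge 3$. Let $\mathcal A_\alpha$ be the group of all Möbius transformations $f$ of $\widehat{\mathbb C}$ with $f(\alpha)=\alpha$. For an integer $m\ge1$ and $z\in\mathbb C^*=\mathbb C\setminus\{0\}$ put $C_m(z)=\{e^{2\pi i k/m}z : k\in\mathbb Z\}$. Then $\mathcal A_\alpha$ equals the cyclic group $G=\langle z\mapsto e^{2\pi i/n}z\rangle\simeq\mathbb Z_n$ if and only if all of the following hold: 1. $\alpha$ is a union of certain elements of $\{\{\infty\},\{0\}\}\cup\{C_n(z) : z\in\mathbb C^*\}$; 2. for every integer $p\ge2$, $\alpha$ is not a union of certain elements of $\{\{\infty\},\{0\}\}\cup\{C_{pn}(z) : z\in\mathbb C^*\}$; 3. $\alpha$ is not in the icosahedral, octahedral, tetrahedral or dihedral case; that is, $\mathcal A_\alpha$ is not isomorphic to $A_5$, $S_4$, $A_4$, or to a dihedral group $D_m$ of order $2m$ with $m\ge2$ (where $D_2$ is the Klein four-group). The equivalence also holds when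 condition 3 is read in terms of orbits: there is no group $H$ of Möbius transformations isomorphic to $A_5$, $S_4$, $A_4$ or $D_m$ ($m\ge2$) such that $\alpha$ is a union of orbits of $H$. -/

import Mathlib

open scoped Pointwise

noncomputable section

namespace SphereStabilizer

/-- The group of all Möbius transformations of the extended complex plane `OnePoint ℂ`: the
permutations induced by invertible complex `2 × 2` matrices through
`z ↦ (a z + b) / (c z + d)`. -/
def Moebius : Subgroup (Equiv.Perm (OnePoint ℂ)) :=
  (MulAction.toPermHom (GL (Fin 2) ℂ) (OnePoint ℂ)).range

/-- The stabilizer of `α`: all Möbius transformations `f` with `f(α) = α`. -/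
def stab (α : Set (OnePoint ℂ)) : Subgroup Moebius :=
  MulAction.stabilizer Moebius α

theorem mem_stab_iff (α : Set (OnePoint ℂ)) (f : Moebius) :
    f ∈ stab α ↔ (f : Equiv.Perm (OnePoint ℂ)) '' α = α :=
  Iff.rfl

/-- The number `e^{2πi/n}`. -/
def zeta (n : ℕ) : ℂ := Complex.exp (2 * Real.pi * Complex.I / n)

theorem zeta_ne_zero (n : ℕ) : zeta n ≠ 0 := Complex.exp_ne_zero _

/-- The rotation `z ↦ e^{2πi/n} z` as a Möbius transformation. -/
def rotation (n : ℕ) : Moebius :=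
  ⟨MulAction.toPermHom (GL (Fin 2) ℂ) (OnePoint ℂ)
      (Matrix.GeneralLinearGroup.mkOfDetNeZero !![zeta n, 0; 0, 1] (by simp [zeta_ne_zero])),
    ⟨_, rfl⟩⟩

theorem rotation_apply_coe (n : ℕ) (z : ℂ) :
    (rotation n : Equiv.Perm (OnePoint ℂ)) (z : OnePoint ℂ) = ((zeta n * z : ℂ) : OnePoint ℂ) := by
  simp [rotation, OnePoint.smul_some_eq_ite, Matrix.GeneralLinearGroup.mkOfDetNeZero]

theorem rotation_apply_infty (n : ℕ) :
    (rotation n : Equiv.Perm (OnePoint ℂ)) OnePoint.infty = OnePoint.infty := by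
  simp [rotation, OnePoint.smul_infty_eq_ite, Matrix.GeneralLinearGroup.mkOfDetNeZero]

/-- The cyclic group generated by `z ↦ e^{2πi/n} z`. -/
def cyclicGroup (n : ℕ) : Subgroup Moebius := Subgroup.zpowers (rotation n)

/-- `C_n(z) = {e^{2πik/n} z | k ∈ ℤ}`. -/
def circleOrbit (n : ℕ) (z : ℂ) : Set (OnePoint ℂ) :=
  {w | ∃ k : ℤ, w = ((Complex.exp (2 * Real.pi * Complex.I * k / n) * z : ℂ) : OnePoint ℂ)}

/-- The family `{{∞}, {0}} ∪ {C_n(z) | z ∈ ℂ, z ≠ 0}`. -/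
def cyclicPieces (n : ℕ) : Set (Set (OnePoint ℂ)) :=
  {{OnePoint.infty}, {((0 : ℂ) : OnePoint ℂ)}} ∪ {C | ∃ z : ℂ, z ≠ 0 ∧ C = circleOrbit n z}

/-- `α` is a union of certain members of the family `F`. -/
def IsUnionOf (F : Set (Set (OnePoint ℂ))) (α : Set (OnePoint ℂ)) : Prop :=
  ∃ T : Set (Set (OnePoint ℂ)), T ⊆ F ∧ α = ⋃₀ T

/-- The family of all orbits of a group `H` of Möbius transformations. -/
def orbits (H : Subgroup Moebius) : Set (Set (OnePoint ℂ)) :=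
  {C | ∃ x : OnePoint ℂ, C = {y | ∃ h ∈ H, y = (h : Equiv.Perm (OnePoint ℂ)) x}}

/-- `H` is an icosahedral (`A₅`), octahedral (`S₄`), tetrahedral (`A₄`) or dihedral
(`D_m` of order `2m`, `m ≥ 2`; `D_2` is the Klein four-group) group. -/
def IsPolyhedralOrDihedral (H : Subgroup Moebius) : Prop :=
  Nonempty (H ≃* alternatingGroup (Fin 5)) ∨
  Nonempty (H ≃* Equiv.Perm (Fin 4)) ∨
  Nonempty (H ≃* alternatingGroup (Fin 4)) ∨
  ∃ m : ℕ, 2 ≤ m ∧ Nonempty (H ≃* DihedralGroup m)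

end SphereStabilizer

end

/-! The pieces in `cyclicPieces n` are the orbits of the group generated by `rotation n`, so
conditions 1 and 2 say that `rotation n` stabilizes `α` and that `rotation (p * n)` does not for any
`p ≥ 2`. Since a Möbius map fixing three points is trivial, `stab α` is finite, and the theorem
rests on Klein's classification of finite Möbius groups (`isCyclic_or_isPolyhedralOrDihedral`).

For the classification, a finite group `G` acts on its poles, the fixed points of its nontrivial
elements. Each such element has exactly two fixed points, and point stabilizers are cyclic.
Burnside's lemma leaves two or three orbits: two give a cyclic group, three give the stabilizer
orders (2,2,m), (2,3,3), (2,3,4), (2,3,5). The last three are recognized as `A₄`, `S₄`, `A₅` by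
faithful conjugation on four Sylow 3-subgroups or five Sylow 2-subgroups.

If `stab α` is cyclic and contains `rotation n`, its generator has the same fixed points 0 and ∞,
hence the group is generated by a rotation; condition 2 forces its order to be `n`. Conversely,
cyclic groups have no polyhedral or dihedral subgroups. -/

namespace SphereStabilizer

/-! ### Recognizing symmetric, alternating and dihedral groups. -/

section GroupTheory

/-- If no nontrivial element lies in all Sylow `p`-subgroups and no element of order `p` commutes
with an element of another prime order, then conjugation on the Sylow `p`-subgroups is faithful. -/
theorem toPermHom_sylow_injective {G : Type*} [Group G] [Finite G] {p : ℕ} [hp : Fact p.Prime]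
    (hdvd : p ∣ Nat.card G)
    (hcore : ∀ g : G, (∀ P : Sylow p G, g ∈ (P : Subgroup G)) → g = 1)
    (hord : ∀ x : G, ∀ q : ℕ, q.Prime → q ≠ p → orderOf x ≠ q * p) :
    Function.Injective (MulAction.toPermHom G (Sylow p G)) := by
  rw [← MonoidHom.ker_eq_bot_iff, Subgroup.eq_bot_iff_forall]
  set K := (MulAction.toPermHom G (Sylow p G)).ker with hK
  have hfix : ∀ g ∈ K, ∀ P : Sylow p G, g • P = P := by
    intro g hg P
    rw [hK, MonoidHom.mem_ker] at hg
    exact congrArg (fun f : Equiv.Perm (Sylow p G) => f P) hg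
  -- A `p`-element normalizing a Sylow `p`-subgroup lies in it, so a `p`-element of the kernel lies
  -- in all of them.
  have hpow : ∀ g ∈ K, ∀ k : ℕ, orderOf g = p ^ k → g = 1 := by
    intro g hg k hk
    refine hcore g fun P => ?_
    have hz : IsPGroup p (Subgroup.zpowers g) := by
      apply IsPGroup.of_card (n := k)
      rw [Nat.card_zpowers, hk]
    have : P ∈ MulAction.fixedPoints (Subgroup.zpowers g) (Sylow p G) := by
      rintro ⟨h, hh⟩
      exact hfix h ((Subgroup.zpowers_le.2 hg) hh) P
    exact (hz.sylow_mem_fixedPoints_iff.1 this) (Subgroup.mem_zpowers g)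
  intro g hg
  obtain ⟨P⟩ : Nonempty (Sylow p G) := inferInstance
  obtain ⟨⟨t, htP⟩, ht⟩ := exists_prime_orderOf_dvd_card' p (P.dvd_card_of_dvd_card hdvd)
  rw [Subgroup.orderOf_mk] at ht
  have hnorm := Sylow.smul_eq_iff_mem_normalizer.1 (hfix g hg P)
  -- The commutator lies in `P` because `g` normalizes `P`, and in `K` because `K` is normal; being
  -- a `p`-element of `K` it is trivial, so `g` commutes with `t`.
  have h1 : g * t * g⁻¹ * t⁻¹ ∈ (P : Subgroup G) :=
    mul_mem ((Subgroup.mem_normalizer_iff.1 hnorm t).1 htP) (inv_mem htP)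
  have h2 : g * t * g⁻¹ * t⁻¹ ∈ K := by
    have : t * g⁻¹ * t⁻¹ ∈ K := (MonoidHom.normal_ker _).conj_mem _ (inv_mem hg) t
    simpa [mul_assoc] using mul_mem hg this
  obtain ⟨k, hk⟩ := (IsPGroup.iff_orderOf.1 P.isPGroup') ⟨_, h1⟩
  rw [Subgroup.orderOf_mk] at hk
  have h3 := hpow _ h2 k hk
  have hc : Commute g t := by
    rw [mul_inv_eq_one, mul_inv_eq_iff_eq_mul] at h3
    exact h3
  refine hpow g hg _ (Nat.eq_prime_pow_of_unique_prime_dvd (orderOf_pos g).ne' ?_)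
  intro q hq hqd
  by_contra hqp
  have h4 : orderOf (g ^ (orderOf g / q)) = q :=
    orderOf_pow_orderOf_div (orderOf_pos g).ne' hqd
  refine hord (g ^ (orderOf g / q) * t) q hq hqp ?_
  have h5 := (hc.pow_left (orderOf g / q)).orderOf_mul_eq_mul_orderOf_of_coprime
    (by rw [h4, ht]; exact (Nat.coprime_primes hq hp.out).2 hqp)
  rw [h5, h4, ht]

theorem nonempty_mulEquiv_perm_of_injective {G α : Type*} [Group G] [Finite α] {k : ℕ}
    (hα : Nat.card α = k) (f : G →* Equiv.Perm α) (hf : Function.Injective f)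
    (hG : Nat.card G = k.factorial) : Nonempty (G ≃* Equiv.Perm (Fin k)) := by
  have e : Equiv.Perm α ≃* Equiv.Perm (Fin k) := (Finite.equivFinOfCardEq hα).permCongrHom
  have hb : Function.Bijective f := by
    refine (Nat.bijective_iff_injective_and_card f).2 ⟨hf, ?_⟩
    rw [hG, Nat.card_perm, hα]
  exact ⟨(MulEquiv.ofBijective f hb).trans e⟩

theorem nonempty_mulEquiv_alternatingGroup_of_injective {G α : Type*} [Group G] [Finite α] {k : ℕ}
    (hα : Nat.card α = k) (f : G →* Equiv.Perm α) (hf : Function.Injective f)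
    (hG : 2 * Nat.card G = k.factorial) : Nonempty (G ≃* alternatingGroup (Fin k)) := by
  let e : Equiv.Perm α ≃* Equiv.Perm (Fin k) := (Finite.equivFinOfCardEq hα).permCongrHom
  let f' : G →* Equiv.Perm (Fin k) := e.toMonoidHom.comp f
  have hf' : Function.Injective f' := e.injective.comp hf
  have hcard : Nat.card f'.range = Nat.card G := Nat.card_congr (f'.ofInjective hf').toEquiv.symm
  have hidx : f'.range.index = 2 := by
    have h1 := f'.range.card_mul_index
    rw [hcard, Nat.card_perm, Nat.card_fin, ← hG, mul_comm] at h1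
    have : Nat.card G ≠ 0 := by
      intro h
      rw [h] at hG
      exact (Nat.factorial_ne_zero k) hG.symm
    exact Nat.eq_of_mul_eq_mul_right (Nat.pos_of_ne_zero this) h1
  rw [← Equiv.Perm.eq_alternatingGroup_of_index_eq_two hidx]
  exact ⟨f'.ofInjective hf'⟩

/-- For `t` outside `C` and `c` in `C`, both `t` and `t * c` are involutions, so conjugation by `t`
inverts `C`. -/
theorem nonempty_mulEquiv_dihedralGroup {G : Type*} [Group G] [Finite G] (C : Subgroup G)
    [IsCyclic C] (hcard : 2 * Nat.card C = Nat.card G) (hinv : ∀ t ∉ C, t * t = 1) :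
    Nonempty (G ≃* DihedralGroup (Nat.card C)) := by
  have hCpos : 0 < Nat.card C := Nat.card_pos
  obtain ⟨t, ht⟩ : ∃ t, t ∉ C := by
    by_contra! h
    have : C = ⊤ := by ext; simp [h]
    rw [this, Subgroup.card_top] at hcard
    rw [this, Subgroup.card_top] at hCpos
    omega
  let e : Multiplicative (ZMod (Nat.card C)) ≃* C := zmodCyclicMulEquiv inferInstance
  let ρ : ZMod (Nat.card C) → G := fun i => (e (Multiplicative.ofAdd i) : G)
  have hadd : ∀ i j, ρ (i + j) = ρ i * ρ j := fun i j => by simp [ρ, ofAdd_add]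
  have hρC : ∀ i, ρ i ∈ C := fun i => (e (Multiplicative.ofAdd i)).2
  have hsub : ∀ i j, ρ (j - i) = (ρ i)⁻¹ * ρ j := fun i j => by
    rw [eq_inv_mul_iff_mul_eq, ← hadd]; congr 1; ring
  have hρinj : Function.Injective ρ := fun i j h => by
    simpa [ρ] using h
  have hconj : ∀ i, t * ρ i * t = (ρ i)⁻¹ := by
    intro i
    rw [eq_inv_iff_mul_eq_one]
    have := hinv (t * ρ i) (fun h => ht ((Subgroup.mul_mem_cancel_right C (hρC i)).1 h))
    simpa [mul_assoc] using this
  have htt : t * t = 1 := hinv t ht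
  have hconj' : ∀ i, ρ i * t = t * (ρ i)⁻¹ := by
    intro i
    rw [← hconj i, ← mul_assoc, ← mul_assoc, htt, one_mul]
  let f : DihedralGroup (Nat.card C) → G := fun x => match x with
    | .r i => ρ i
    | .sr i => t * ρ i
  have hmul : ∀ x y, f (x * y) = f x * f y := by
    rintro (i | i) (j | j)
    · simp only [DihedralGroup.r_mul_r, f, hadd]
    · simp only [DihedralGroup.r_mul_sr, f, hsub]
      rw [← mul_assoc, ← mul_assoc, hconj']
    · simp only [DihedralGroup.sr_mul_r, f, hadd, mul_assoc]
    · simp only [DihedralGroup.sr_mul_sr, f, hsub]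
      rw [← mul_assoc, hconj]
  have hinj : Function.Injective f := by
    rintro (i | i) (j | j) h
    · rw [hρinj h]
    · exact absurd ((Subgroup.mul_mem_cancel_right C (hρC j)).1
        ((show ρ i = t * ρ j from h) ▸ hρC i)) ht
    · exact absurd ((Subgroup.mul_mem_cancel_right C (hρC i)).1
        ((show t * ρ i = ρ j from h).symm ▸ hρC j)) ht
    · rw [hρinj (mul_left_cancel (show t * ρ i = t * ρ j from h))]
  let F : DihedralGroup (Nat.card C) →* G := MonoidHom.mk' f hmul
  have hb : Function.Bijective F :=
    (Nat.bijective_iff_injective_and_card F).2 ⟨hinj, by rw [DihedralGroup.nat_card, hcard]⟩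
  exact ⟨(MulEquiv.ofBijective F hb).symm⟩

end GroupTheory

/-! ### Counting orbits when every nontrivial element has two fixed points. -/

section Action

open MulAction

theorem natCard_orbit_mul_natCard_stabilizer (G : Type*) {X : Type*} [Group G] [MulAction G X]
    (x : X) : Nat.card (orbit G x) * Nat.card (stabilizer G x) = Nat.card G := by
  rw [← Nat.card_prod]
  exact Nat.card_congr (orbitProdStabilizerEquivGroup G x)

theorem natCard_stabilizer_eq_of_mem_orbit {G X : Type*} [Group G] [MulAction G X]
    {x y : X} (h : y ∈ orbit G x) : Nat.card (stabilizer G y) = Nat.card (stabilizer G x) := by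
  rw [← orbitRel_apply] at h
  exact Nat.card_congr (stabilizerEquivStabilizerOfOrbitRel h).toEquiv

theorem mul_self_eq_one_of_natCard_eq_two {G : Type*} [Group G] {H : Subgroup G} (h : Nat.card H = 2) {g : G}
    (hg : g ∈ H) : g * g = 1 := by
  have h1 := H.orderOf_dvd_natCard hg
  rw [h] at h1
  rw [← pow_two]
  exact orderOf_dvd_iff_pow_eq_one.1 h1

theorem exists_fixed_of_natCard_fixedBy {G X : Type*} [Group G] [MulAction G X] {g : G} (h : Nat.card (fixedBy X g) = 2) :
    ∃ x : X, g ∈ stabilizer G x := by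
  have : Nonempty (fixedBy X g) := (Nat.card_pos_iff.1 (by omega)).1
  obtain ⟨x, hx⟩ := this
  exact ⟨x, hx⟩

theorem two_le_natCard_stabilizer {G X : Type*} [Group G] [Finite G] [MulAction G X] {x : X} (h : stabilizer G x ≠ ⊥) :
    2 ≤ Nat.card (stabilizer G x) :=
  (Subgroup.one_lt_card_iff_ne_bot _).2 h

theorem natCard_eq_sum_orbits {G X : Type*} [Group G] [MulAction G X] [Finite X]
    [Fintype (Quotient (orbitRel G X))] :
    Nat.card X = ∑ ω : Quotient (orbitRel G X), Nat.card (orbit G ω.out) := by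
  rw [Nat.card_congr (selfEquivSigmaOrbits G X), Nat.card_sigma]

variable {G X : Type*} [Group G] [Finite G] [MulAction G X]

theorem nonempty_mulEquiv_dihedralGroup_of_stabilizers {x y z : X}
    (hfix : ∀ g : G, g ≠ 1 → Nat.card (fixedBy X g) = 2)
    (hcyc : ∀ x : X, IsCyclic (stabilizer G x))
    (hcov : ∀ w, w ∈ orbit G x ∨ w ∈ orbit G y ∨ w ∈ orbit G z)
    (hx : Nat.card (stabilizer G x) = 2) (hy : Nat.card (stabilizer G y) = 2)
    (hz : 2 * Nat.card (stabilizer G z) = Nat.card G) :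
    Nonempty (G ≃* DihedralGroup (Nat.card (stabilizer G z))) := by
  have := hcyc z
  refine nonempty_mulEquiv_dihedralGroup _ hz fun t ht => ?_
  have ht1 : t ≠ 1 := fun h => ht (h ▸ one_mem _)
  obtain ⟨w, hw⟩ := exists_fixed_of_natCard_fixedBy (hfix t ht1)
  rcases hcov w with h | h | h
  · exact mul_self_eq_one_of_natCard_eq_two
      ((natCard_stabilizer_eq_of_mem_orbit h).trans hx) hw
  · exact mul_self_eq_one_of_natCard_eq_two
      ((natCard_stabilizer_eq_of_mem_orbit h).trans hy) hw
  -- The stabilizer of `z` has index 2, hence is normal, so it is also the stabilizer of every point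
  -- in the orbit of `z`.
  · exfalso
    apply ht
    obtain ⟨g, rfl⟩ := h
    have hnorm : (stabilizer G z).Normal := by
      apply Subgroup.normal_of_index_eq_two
      have h1 := (stabilizer G z).card_mul_index
      have h2 : 0 < Nat.card (stabilizer G z) := Nat.card_pos
      rw [← hz, mul_comm 2] at h1
      exact Nat.eq_of_mul_eq_mul_left h2 h1
    have h1 : g⁻¹ * t * g ∈ stabilizer G z := by
      rw [mem_stabilizer_iff, mul_smul, mul_smul, inv_smul_eq_iff]
      exact hw
    simpa [mul_assoc] using hnorm.conj_mem _ h1 g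

variable [Finite X]

/-- Burnside's lemma: the identity contributes all of `X`, every other element contributes 2. -/
theorem natCard_add_eq_of_natCard_fixedBy
    (hfix : ∀ g : G, g ≠ 1 → Nat.card (fixedBy X g) = 2) :
    Nat.card X + 2 * (Nat.card G - 1) =
      Nat.card (Quotient (orbitRel G X)) * Nat.card G := by
  classical
  have := Fintype.ofFinite G
  have := Fintype.ofFinite X
  have := Fintype.ofFinite (Quotient (orbitRel G X))
  have h := sum_card_fixedBy_eq_card_orbits_mul_card_group G X
  simp only [← Nat.card_eq_fintype_card] at h
  rw [← h, ← Finset.add_sum_erase _ _ (Finset.mem_univ (1 : G)),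
    Finset.sum_congr rfl (fun g hg => hfix g (Finset.ne_of_mem_erase hg))]
  rw [Finset.sum_const, Finset.card_erase_of_mem (Finset.mem_univ _), Finset.card_univ,
    smul_eq_mul, mul_comm 2, Nat.card_eq_fintype_card (α := G), fixedBy_one_eq_univ]
  congr 1
  exact (Nat.card_congr (Equiv.Set.univ X)).symm

/-- Nontrivial stabilizers bound each orbit by half of `|G|`. With Burnside's count, `k` orbits
satisfy `k|G| ≤ 4(|G| - 1)`, so `k < 4`. -/
theorem natCard_orbits_eq (hG : 2 ≤ Nat.card G)
    (hfix : ∀ g : G, g ≠ 1 → Nat.card (fixedBy X g) = 2)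
    (hstab : ∀ x : X, stabilizer G x ≠ ⊥) :
    Nat.card (Quotient (orbitRel G X)) = 2 ∨ Nat.card (Quotient (orbitRel G X)) = 3 := by
  have := Fintype.ofFinite (Quotient (orbitRel G X))
  have h1 := natCard_add_eq_of_natCard_fixedBy hfix
  have h2 := natCard_eq_sum_orbits (G := G) (X := X)
  have h3 : 2 * Nat.card X ≤ Nat.card (Quotient (orbitRel G X)) * Nat.card G := by
    rw [h2, Finset.mul_sum, Nat.card_eq_fintype_card (α := Quotient (orbitRel G X)),
      ← Finset.card_univ, ← smul_eq_mul, ← Finset.sum_const]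
    refine Finset.sum_le_sum fun ω _ => ?_
    rw [← natCard_orbit_mul_natCard_stabilizer G ω.out, mul_comm]
    exact Nat.mul_le_mul_left _ (two_le_natCard_stabilizer (hstab _))
  have h4 : Nat.card (Quotient (orbitRel G X)) ≤ Nat.card X :=
    Nat.card_le_card_of_surjective _ Quotient.mk_surjective
  obtain ⟨N, hN⟩ : ∃ N, Nat.card G = N + 2 := ⟨Nat.card G - 2, by omega⟩
  rw [hN] at h1 h3
  generalize Nat.card (Quotient (orbitRel G X)) = k at *
  have hk : k < 4 := by
    by_contra! hk
    have : N + 2 - 1 = N + 1 := by omega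
    rw [this] at h1
    nlinarith
  interval_cases k <;> omega

/-- The numerical solutions of the class equation with three orbits. -/
theorem class_equation_solutions {N a b c e f g : ℕ} (ha : a * e = N) (hb : b * f = N)
    (hc : c * g = N) (he : 2 ≤ e) (hef : e ≤ f) (hfg : f ≤ g) (hsum : a + b + c = N + 2) :
    (e = 2 ∧ f = 2 ∧ 2 * g = N) ∨ (e = 2 ∧ f = 3 ∧ g = 3 ∧ N = 12) ∨
      (e = 2 ∧ f = 3 ∧ g = 4 ∧ N = 24) ∨ (e = 2 ∧ f = 3 ∧ g = 5 ∧ N = 60) := by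
  -- All three bounds come from comparing the total orbit size with `N + 2`: were `e ≥ 3`, it would
  -- be at most `3 · N/3`; were `f ≥ 4`, at most `N/2 + N/4 + N/4`; were `g ≥ 6` with `f = 3`, at
  -- most `N/2 + N/3 + N/6`.
  have he2 : e = 2 := by
    by_contra h
    have h3 : 3 ≤ e := by omega
    have h1 : a * 3 ≤ N := ha ▸ Nat.mul_le_mul_left a h3
    have h2 : b * 3 ≤ N := hb ▸ Nat.mul_le_mul_left b (by omega)
    have h3 : c * 3 ≤ N := hc ▸ Nat.mul_le_mul_left c (by omega)
    omega
  subst he2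
  have hf3 : f < 4 := by
    by_contra! h
    have h2 : b * 4 ≤ N := hb ▸ Nat.mul_le_mul_left b (by omega)
    have h3 : c * 4 ≤ N := hc ▸ Nat.mul_le_mul_left c (by omega)
    omega
  interval_cases f
  · left
    have : c = 2 := by omega
    subst this
    omega
  · right
    have hg : g < 6 := by
      by_contra! h
      have h3 : c * 6 ≤ N := hc ▸ Nat.mul_le_mul_left c (by omega)
      omega
    interval_cases g <;> omega

/-- The cardinalities of the stabilizers of representatives of the three orbits. -/
theorem exists_orbit_representatives (hG : 2 ≤ Nat.card G)
    (hfix : ∀ g : G, g ≠ 1 → Nat.card (fixedBy X g) = 2)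
    (hstab : ∀ x : X, stabilizer G x ≠ ⊥)
    (h3 : Nat.card (Quotient (orbitRel G X)) = 3) :
    ∃ x y z : X, (∀ w, w ∈ orbit G x ∨ w ∈ orbit G y ∨ w ∈ orbit G z) ∧
      ((Nat.card (stabilizer G x) = 2 ∧ Nat.card (stabilizer G y) = 2 ∧
          2 * Nat.card (stabilizer G z) = Nat.card G) ∨
        (Nat.card (stabilizer G x) = 2 ∧ Nat.card (stabilizer G y) = 3 ∧
          Nat.card (stabilizer G z) = 3 ∧ Nat.card G = 12) ∨
        (Nat.card (stabilizer G x) = 2 ∧ Nat.card (stabilizer G y) = 3 ∧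
          Nat.card (stabilizer G z) = 4 ∧ Nat.card G = 24) ∨
        (Nat.card (stabilizer G x) = 2 ∧ Nat.card (stabilizer G y) = 3 ∧
          Nat.card (stabilizer G z) = 5 ∧ Nat.card G = 60)) := by
  have := Fintype.ofFinite (Quotient (orbitRel G X))
  have h1 := natCard_add_eq_of_natCard_fixedBy hfix
  have h2 := natCard_eq_sum_orbits (G := G) (X := X)
  let e := Finite.equivFinOfCardEq h3
  rw [← e.symm.sum_comp, Fin.sum_univ_three] at h2
  rw [h3] at h1
  set x := (e.symm 0).out
  set y := (e.symm 1).out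
  set z := (e.symm 2).out
  have hcov : ∀ w, w ∈ orbit G x ∨ w ∈ orbit G y ∨ w ∈ orbit G z := by
    intro w
    have key : ∀ i, e (Quotient.mk _ w) = i → w ∈ orbit G (e.symm i).out := by
      rintro i rfl
      rw [e.symm_apply_apply, ← orbitRel_apply]
      exact (orbitRel G X).symm' (Quotient.mk_out (s := orbitRel G X) w)
    obtain h | h | h : e (Quotient.mk _ w) = 0 ∨ e (Quotient.mk _ w) = 1 ∨
        e (Quotient.mk _ w) = 2 := by
      generalize e (Quotient.mk _ w) = i
      fin_cases i <;> simp
    · exact .inl (key 0 h)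
    · exact .inr (.inl (key 1 h))
    · exact .inr (.inr (key 2 h))
  have hsum : Nat.card (orbit G x) + Nat.card (orbit G y) + Nat.card (orbit G z) =
      Nat.card G + 2 := by omega
  suffices hmain : ∃ x y z : X, (∀ w, w ∈ orbit G x ∨ w ∈ orbit G y ∨ w ∈ orbit G z) ∧
      Nat.card (orbit G x) + Nat.card (orbit G y) + Nat.card (orbit G z) = Nat.card G + 2 ∧
      Nat.card (stabilizer G x) ≤ Nat.card (stabilizer G y) ∧
      Nat.card (stabilizer G y) ≤ Nat.card (stabilizer G z) by
    obtain ⟨x, y, z, hcov, hsum, hxy, hyz⟩ := hmain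
    exact ⟨x, y, z, hcov, class_equation_solutions (natCard_orbit_mul_natCard_stabilizer G x)
      (natCard_orbit_mul_natCard_stabilizer G y) (natCard_orbit_mul_natCard_stabilizer G z)
      (two_le_natCard_stabilizer (hstab x)) hxy hyz hsum⟩
  rcases le_total (Nat.card (stabilizer G x)) (Nat.card (stabilizer G y)) with hxy | hxy <;>
  rcases le_total (Nat.card (stabilizer G y)) (Nat.card (stabilizer G z)) with hyz | hyz <;>
  rcases le_total (Nat.card (stabilizer G x)) (Nat.card (stabilizer G z)) with hxz | hxz
  · exact ⟨x, y, z, hcov, hsum, hxy, hyz⟩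
  · exact ⟨x, y, z, hcov, hsum, hxy, hyz⟩
  · exact ⟨x, z, y, fun w => by have := hcov w; tauto, by omega, hxz, hyz⟩
  · exact ⟨z, x, y, fun w => by have := hcov w; tauto, by omega, hxz, hxy⟩
  · exact ⟨y, x, z, fun w => by have := hcov w; tauto, by omega, hxy, hxz⟩
  · exact ⟨y, z, x, fun w => by have := hcov w; tauto, by omega, hyz, hxz⟩
  · exact ⟨z, y, x, fun w => by have := hcov w; tauto, by omega, hyz, hxy⟩
  · exact ⟨z, y, x, fun w => by have := hcov w; tauto, by omega, hyz, hxy⟩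

/-- Burnside's count gives `|X| = 2`, so both orbits are single points and `G` is a point
stabilizer. -/
theorem isCyclic_of_two_orbits (hG : 2 ≤ Nat.card G)
    (hfix : ∀ g : G, g ≠ 1 → Nat.card (fixedBy X g) = 2)
    (hcyc : ∀ x : X, IsCyclic (stabilizer G x))
    (h2 : Nat.card (Quotient (orbitRel G X)) = 2) : IsCyclic G := by
  have h1 := natCard_add_eq_of_natCard_fixedBy hfix
  have hX : Nat.card X = Nat.card (Quotient (orbitRel G X)) := by rw [h2] at h1; omega
  have hb : Function.Bijective (Quotient.mk (orbitRel G X)) :=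
    (Nat.bijective_iff_surjective_and_card _).2 ⟨Quotient.mk_surjective, hX⟩
  have : Nonempty X := (Nat.card_pos_iff.1 (by omega)).1
  obtain ⟨x⟩ := this
  have htop : stabilizer G x = ⊤ := by
    ext g
    simp only [Subgroup.mem_top, iff_true, mem_stabilizer_iff]
    apply hb.1
    exact Quotient.sound (orbitRel_apply.2 (mem_orbit x g))
  have := hcyc x
  rw [htop] at this
  exact isCyclic_of_surjective (Subgroup.topEquiv : (⊤ : Subgroup G) ≃* G)
    (MulEquiv.surjective _)

/-! ### Sylow actions for orders 12, 24 and 60, and the abstract classification. -/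

theorem factorization_pow_mul {p k m : ℕ} [hp : Fact p.Prime] (hm : ¬ p ∣ m) :
    (p ^ k * m).factorization p = k := by
  have hm0 : m ≠ 0 := fun h => hm (h ▸ dvd_zero p)
  rw [Nat.factorization_mul (pow_ne_zero _ hp.out.ne_zero) hm0, Finsupp.add_apply,
    hp.out.factorization_pow, Finsupp.single_eq_same, Nat.factorization_eq_zero_of_not_dvd hm,
    add_zero]

/-- Stabilizers of order `3` in groups of order `12` or `24`: there are four Sylow `3`-subgroups,
and they are permuted faithfully. -/
theorem sylow_three_action (hfix : ∀ g : G, g ≠ 1 → Nat.card (fixedBy X g) = 2)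
    (hcard : Nat.card G = 12 ∨ Nat.card G = 24) {y : X} (hy : Nat.card (stabilizer G y) = 3)
    (hall : ∀ w : X, Nat.card (stabilizer G w) ≤ 4) :
    Nat.card (Sylow 3 G) = 4 ∧ Function.Injective (toPermHom G (Sylow 3 G)) := by
  have : Fact (Nat.Prime 3) := ⟨by norm_num⟩
  have hfac : (Nat.card G).factorization 3 = 1 := by
    rcases hcard with h | h <;> rw [h]
    · exact factorization_pow_mul (m := 4) (k := 1) (p := 3) (by norm_num)
    · exact factorization_pow_mul (m := 8) (k := 1) (p := 3) (by norm_num)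
  have hcore : ∀ g : G, (∀ P : Sylow 3 G, g ∈ (P : Subgroup G)) → g = 1 := by
    intro g hg
    by_contra h1
    -- Stabilizers along this orbit are Sylow 3-subgroups, so `g` would fix `|G|/3 ≥ 4` points.
    have hsub : orbit G y ⊆ fixedBy X g := by
      intro w hw
      have hw3 : Nat.card (stabilizer G w) = 3 ^ (Nat.card G).factorization 3 := by
        rw [natCard_stabilizer_eq_of_mem_orbit hw, hy, hfac, pow_one]
      exact hg (Sylow.ofCard _ hw3)
    have h2 := Nat.card_mono (Set.toFinite _) hsub
    rw [hfix g h1] at h2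
    have h3 := natCard_orbit_mul_natCard_stabilizer G y
    rw [hy] at h3
    omega
  have hP : ∀ P : Sylow 3 G, Nat.card P = 3 := fun P => by
    rw [P.card_eq_multiplicity, hfac, pow_one]
  obtain ⟨P⟩ : Nonempty (Sylow 3 G) := inferInstance
  refine ⟨?_, toPermHom_sylow_injective (by omega) hcore ?_⟩
  · have h1 := card_sylow_modEq_one 3 G
    have h2 := P.card_dvd_index
    have h3 := (P : Subgroup G).card_mul_index
    rw [hP] at h3
    have h4 : Nat.card (Sylow 3 G) ≠ 1 := by
      intro h
      have hs : Subsingleton (Sylow 3 G) := (Nat.card_eq_one_iff_unique.1 h).1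
      have hbot : (P : Subgroup G) = ⊥ := by
        rw [Subgroup.eq_bot_iff_forall]
        intro g hg
        exact hcore g fun Q => Subsingleton.elim P Q ▸ hg
      have := hP P
      rw [show Nat.card P = Nat.card (P : Subgroup G) from rfl, hbot, Subgroup.card_bot] at this
      omega
    -- The only divisor of 8 other than 1 that is congruent to 1 modulo 3 is 4.
    have h5 : Nat.card (Sylow 3 G) ∣ 8 := by
      refine h2.trans ?_
      rcases hcard with h | h <;> rw [h] at h3
      · rw [show (P : Subgroup G).index = 4 by omega]; norm_num
      · rw [show (P : Subgroup G).index = 8 by omega]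
    have h6 := Nat.le_of_dvd (by norm_num) h5
    rw [Nat.ModEq] at h1
    generalize Nat.card (Sylow 3 G) = n at *
    interval_cases n <;> omega
  · intro g q hq hq3 hgq
    have hg1 : g ≠ 1 := by
      rintro rfl
      rw [orderOf_one] at hgq
      omega
    obtain ⟨w, hw⟩ := exists_fixed_of_natCard_fixedBy (hfix g hg1)
    have h1 := Nat.le_of_dvd Nat.card_pos ((stabilizer G w).orderOf_dvd_natCard hw)
    have h2 := hall w
    have h3 := hq.two_le
    omega

/-- In a group of order `60` with stabilizers of orders `2`, `3` and `5` there are `15`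
involutions. -/
theorem card_involutions (hfix : ∀ g : G, g ≠ 1 → Nat.card (fixedBy X g) = 2)
    [Fintype G] [DecidableEq G] (hcard : Nat.card G = 60)
    {x : X} (hx : Nat.card (stabilizer G x) = 2)
    (hall : ∀ w : X, w ∈ orbit G x ∨ Nat.card (stabilizer G w) = 3 ∨
      Nat.card (stabilizer G w) = 5) :
    (Finset.univ.filter fun g : G => orderOf g = 2).card = 15 := by
  classical
  have := Fintype.ofFinite X
  have hO : (Finset.univ.filter fun w : X => w ∈ orbit G x).card = 30 := by
    have h1 := natCard_orbit_mul_natCard_stabilizer G x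
    have h2 : Nat.card (orbit G x) = (Finset.univ.filter fun w : X => w ∈ orbit G x).card := by
      rw [Nat.card_eq_fintype_card, Fintype.card_subtype]
    rw [hx] at h1
    omega
  -- Double counting: each involution has both its fixed points in the 30-point orbit of `x`, and
  -- each point there is fixed by one involution.
  have key := Finset.card_mul_eq_card_mul (fun (g : G) (w : X) => g • w = w)
    (s := Finset.univ.filter fun g : G => orderOf g = 2)
    (t := Finset.univ.filter fun w : X => w ∈ orbit G x) (m := 2) (n := 1) ?_ ?_
  · omega
  · intro g hg
    have hg : orderOf g = 2 := by simpa using hg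
    have hg1 : g ≠ 1 := by rintro rfl; simp at hg
    rw [← hfix g hg1, Nat.card_eq_fintype_card, Fintype.card_subtype]
    congr 1
    ext w
    simp only [Finset.mem_bipartiteAbove, Finset.mem_filter, Finset.mem_univ, true_and,
      mem_fixedBy, and_iff_right_iff_imp]
    intro hw
    have h1 := (stabilizer G w).orderOf_dvd_natCard hw
    rcases hall w with h | h | h
    · exact h
    · rw [hg, h] at h1; omega
    · rw [hg, h] at h1; omega
  · intro w hw
    have hw : w ∈ orbit G x := by simpa using hw
    have h2 := (natCard_stabilizer_eq_of_mem_orbit hw).trans hx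
    obtain ⟨⟨t, htw⟩, ht⟩ := exists_prime_orderOf_dvd_card' 2 h2.symm.dvd
    rw [Subgroup.orderOf_mk] at ht
    have ht1 : t ≠ 1 := by rintro rfl; simp at ht
    rw [Finset.card_eq_one]
    refine ⟨t, ?_⟩
    ext g
    simp only [Finset.mem_bipartiteBelow, Finset.mem_filter, Finset.mem_univ, true_and,
      Finset.mem_singleton]
    constructor
    · rintro ⟨hg, hgw⟩
      have hg1 : g ≠ 1 := by rintro rfl; simp at hg
      obtain ⟨a, b, hab, huniv⟩ := Nat.card_eq_two_iff.1 h2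
      have hmem : ∀ s : stabilizer G w, s = a ∨ s = b := fun s => by
        simpa using huniv.symm.subset (Set.mem_univ s)
      have h3 := hmem ⟨g, hgw⟩
      have h4 := hmem ⟨t, htw⟩
      have h5 := hmem 1
      by_contra hgt
      have h6 : (⟨g, hgw⟩ : stabilizer G w) ≠ 1 := fun h => hg1 (congrArg Subtype.val h)
      have h7 : (⟨t, htw⟩ : stabilizer G w) ≠ 1 := fun h => ht1 (congrArg Subtype.val h)
      have h8 : (⟨g, hgw⟩ : stabilizer G w) ≠ ⟨t, htw⟩ := fun h => hgt (congrArg Subtype.val h)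
      grind
    · rintro rfl
      exact ⟨ht, htw⟩

/-- In a group of order `60` with stabilizers of orders `2`, `3` and `5` there are five Sylow
`2`-subgroups, and they are permuted faithfully. -/
theorem sylow_two_action (hfix : ∀ g : G, g ≠ 1 → Nat.card (fixedBy X g) = 2)
    (hcard : Nat.card G = 60) {x : X} (hx : Nat.card (stabilizer G x) = 2)
    (hall : ∀ w : X, w ∈ orbit G x ∨ Nat.card (stabilizer G w) = 3 ∨
      Nat.card (stabilizer G w) = 5) :
    Nat.card (Sylow 2 G) = 5 ∧ Function.Injective (toPermHom G (Sylow 2 G)) := by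
  classical
  have := Fintype.ofFinite G
  have := Fintype.ofFinite (Sylow 2 G)
  have : Fact (Nat.Prime 2) := ⟨Nat.prime_two⟩
  have hP : ∀ P : Sylow 2 G, Nat.card (P : Subgroup G) = 4 := fun P => by
    have : (60 : ℕ).factorization 2 = 2 :=
      factorization_pow_mul (m := 15) (k := 2) (p := 2) (by norm_num)
    rw [P.card_eq_multiplicity, hcard, this]; rfl
  have hstab : ∀ w : X, Nat.card (stabilizer G w) = 2 ∨ Nat.card (stabilizer G w) = 3 ∨
      Nat.card (stabilizer G w) = 5 := fun w =>
    (hall w).imp_left fun h => (natCard_stabilizer_eq_of_mem_orbit h).trans hx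
  have hord : ∀ g : G, g ≠ 1 → orderOf g = 2 ∨ orderOf g = 3 ∨ orderOf g = 5 := by
    intro g hg
    obtain ⟨w, hw⟩ := exists_fixed_of_natCard_fixedBy (hfix g hg)
    have h1 := (stabilizer G w).orderOf_dvd_natCard hw
    have h2 : orderOf g ≠ 1 := fun h => hg (orderOf_eq_one_iff.1 h)
    rcases hstab w with h | h | h <;> rw [h] at h1
    · exact .inl (((Nat.dvd_prime (by norm_num)).1 h1).resolve_left h2)
    · exact .inr (.inl (((Nat.dvd_prime (by norm_num)).1 h1).resolve_left h2))
    · exact .inr (.inr (((Nat.dvd_prime (by norm_num)).1 h1).resolve_left h2))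
  -- The centralizer of `t` permutes the two fixed points of `t`, and the stabilizer of either has
  -- order at most 2.
  have hcent : ∀ t : G, orderOf t = 2 →
      Nat.card (Subgroup.centralizer ({t} : Set G)) ≤ 4 := by
    intro t ht
    have ht1 : t ≠ 1 := by rintro rfl; simp at ht
    obtain ⟨w, hw⟩ := exists_fixed_of_natCard_fixedBy (hfix t ht1)
    have hw2 : Nat.card (stabilizer G w) = 2 := by
      have h1 := (stabilizer G w).orderOf_dvd_natCard hw
      rcases hstab w with h | h | h
      · exact h
      · rw [ht, h] at h1; omega
      · rw [ht, h] at h1; omega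
    rw [← natCard_orbit_mul_natCard_stabilizer (Subgroup.centralizer ({t} : Set G)) w]
    have h1 : orbit (Subgroup.centralizer ({t} : Set G)) w ⊆ fixedBy X t := by
      rintro _ ⟨⟨c, hc⟩, rfl⟩
      change t • c • w = c • w
      rw [smul_smul, ← Subgroup.mem_centralizer_singleton_iff.1 hc, mul_smul]
      exact congrArg (c • ·) hw
    have h2 := Nat.card_mono (Set.toFinite _) h1
    rw [hfix t ht1] at h2
    have h3 : Nat.card (stabilizer (Subgroup.centralizer ({t} : Set G)) w) ≤ 2 := by
      rw [← hw2]
      refine Nat.card_le_card_of_injective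
        (fun s => (⟨s.1.1, s.2⟩ : stabilizer G w)) fun s s' h => ?_
      exact Subtype.ext (Subtype.ext (Subtype.mk.inj h))
    exact Nat.mul_le_mul h2 h3
  -- A group of order 4 is abelian, so `P` fills the centralizer; thus each involution lies in only
  -- one Sylow 2-subgroup.
  have heq : ∀ t : G, orderOf t = 2 → ∀ P : Sylow 2 G, t ∈ (P : Subgroup G) →
      (P : Subgroup G) = Subgroup.centralizer ({t} : Set G) := by
    intro t ht P htP
    refine Subgroup.eq_of_le_of_card_ge ?_ ((hcent t ht).trans (hP P).ge)
    intro g hg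
    rw [Subgroup.mem_centralizer_singleton_iff]
    have := IsPGroup.isMulCommutative_of_card_eq_prime_sq (p := 2) (hP P)
    exact congrArg Subtype.val (mul_comm' (⟨g, hg⟩ : (P : Subgroup G)) ⟨t, htP⟩)
  have hPord : ∀ P : Sylow 2 G, ∀ g ∈ (P : Subgroup G), g ≠ 1 → orderOf g = 2 := by
    intro P g hg hg1
    have h1 := (P : Subgroup G).orderOf_dvd_natCard hg
    rw [hP] at h1
    rcases hord g hg1 with h | h | h
    · exact h
    · rw [h] at h1; omega
    · rw [h] at h1; omega
  have hfive : Nat.card (Sylow 2 G) = 5 := by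
    -- The 15 involutions are partitioned into triples, one for each Sylow 2-subgroup.
    have key := Finset.card_mul_eq_card_mul (fun (g : G) (P : Sylow 2 G) => g ∈ (P : Subgroup G))
      (s := Finset.univ.filter fun g : G => orderOf g = 2) (t := Finset.univ) (m := 1) (n := 3)
      ?_ ?_
    · rw [card_involutions hfix hcard hx hall, Finset.card_univ, ← Nat.card_eq_fintype_card] at key
      omega
    · intro t ht
      have ht : orderOf t = 2 := by simpa using ht
      have hz : IsPGroup 2 (Subgroup.zpowers t) :=
        IsPGroup.of_card (n := 1) (by rw [Nat.card_zpowers, ht, pow_one])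
      obtain ⟨P, hPt⟩ := hz.exists_le_sylow
      have htP : t ∈ (P : Subgroup G) := hPt (Subgroup.mem_zpowers t)
      rw [Finset.card_eq_one]
      refine ⟨P, ?_⟩
      ext Q
      simp only [Finset.mem_bipartiteAbove, Finset.mem_univ, true_and, Finset.mem_singleton]
      constructor
      · exact fun h => Sylow.ext ((heq t ht Q h).trans (heq t ht P htP).symm)
      · rintro rfl
        exact htP
    · intro P _
      have h1 : (Finset.univ.filter fun g : G => g ∈ (P : Subgroup G)).card = 4 := by
        rw [← hP P, Nat.card_eq_fintype_card, Fintype.card_subtype]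
      have h2 : Finset.bipartiteBelow (fun (g : G) (P : Sylow 2 G) => g ∈ (P : Subgroup G))
          (Finset.univ.filter fun g : G => orderOf g = 2) P =
          (Finset.univ.filter fun g : G => g ∈ (P : Subgroup G)).erase 1 := by
        ext g
        simp only [Finset.mem_bipartiteBelow, Finset.mem_filter, Finset.mem_univ, true_and,
          Finset.mem_erase]
        constructor
        · rintro ⟨h, h'⟩
          exact ⟨by rintro rfl; simp at h, h'⟩
        · rintro ⟨h, h'⟩
          exact ⟨hPord P g h' h, h'⟩
      rw [h2, Finset.card_erase_of_mem (by simp [one_mem]), h1]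
  refine ⟨hfive, toPermHom_sylow_injective (by omega) ?_ ?_⟩
  · intro g hg
    by_contra hg1
    have h1 : Subsingleton (Sylow 2 G) := ⟨fun P Q => Sylow.ext
      ((heq g (hPord P g (hg P) hg1) P (hg P)).trans
        (heq g (hPord P g (hg P) hg1) Q (hg Q)).symm)⟩
    have := Finite.card_le_one_iff_subsingleton.2 h1
    omega
  · intro g q hq hq2 hgq
    have hg1 : g ≠ 1 := by
      rintro rfl
      rw [orderOf_one] at hgq
      omega
    have := hord g hg1
    have := hq.two_le
    omega

/-- The classification of finite groups acting such that every nontrivial element has exactly two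
fixed points and all stabilizers are nontrivial and cyclic. -/
theorem classification_of_action (hG : 2 ≤ Nat.card G)
    (hfix : ∀ g : G, g ≠ 1 → Nat.card (fixedBy X g) = 2)
    (hstab : ∀ x : X, stabilizer G x ≠ ⊥) (hcyc : ∀ x : X, IsCyclic (stabilizer G x)) :
    IsCyclic G ∨ Nonempty (G ≃* alternatingGroup (Fin 5)) ∨
      Nonempty (G ≃* Equiv.Perm (Fin 4)) ∨ Nonempty (G ≃* alternatingGroup (Fin 4)) ∨
      ∃ m : ℕ, 2 ≤ m ∧ Nonempty (G ≃* DihedralGroup m) := by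
  rcases natCard_orbits_eq hG hfix hstab with h2 | h3
  · exact .inl (isCyclic_of_two_orbits hG hfix hcyc h2)
  right
  obtain ⟨x, y, z, hcov, h⟩ := exists_orbit_representatives hG hfix hstab h3
  have hcards : ∀ w, Nat.card (stabilizer G w) = Nat.card (stabilizer G x) ∨
      Nat.card (stabilizer G w) = Nat.card (stabilizer G y) ∨
      Nat.card (stabilizer G w) = Nat.card (stabilizer G z) := fun w =>
    (hcov w).imp natCard_stabilizer_eq_of_mem_orbit
      (Or.imp natCard_stabilizer_eq_of_mem_orbit natCard_stabilizer_eq_of_mem_orbit)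
  rcases h with ⟨hx, hy, hz⟩ | ⟨hx, hy, hz, hc⟩ | ⟨hx, hy, hz, hc⟩ | ⟨hx, hy, hz, hc⟩
  · exact .inr (.inr (.inr ⟨_, two_le_natCard_stabilizer (hstab z),
      nonempty_mulEquiv_dihedralGroup_of_stabilizers hfix hcyc hcov hx hy hz⟩))
  · obtain ⟨h4, hinj⟩ := sylow_three_action hfix (.inl hc) hy
      (fun w => by have := hcards w; omega)
    refine .inr (.inr (.inl (nonempty_mulEquiv_alternatingGroup_of_injective h4 _ hinj ?_)))
    rw [hc]; rfl
  · obtain ⟨h4, hinj⟩ := sylow_three_action hfix (.inr hc) hy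
      (fun w => by have := hcards w; omega)
    refine .inr (.inl (nonempty_mulEquiv_perm_of_injective h4 _ hinj ?_))
    rw [hc]; rfl
  · obtain ⟨h5, hinj⟩ := sylow_two_action hfix hc hx fun w => (hcov w).imp_right
      (Or.imp (fun h => (natCard_stabilizer_eq_of_mem_orbit h).trans hy)
        (fun h => (natCard_stabilizer_eq_of_mem_orbit h).trans hz))
    refine .inl (nonempty_mulEquiv_alternatingGroup_of_injective h5 _ hinj ?_)
    rw [hc]; rfl

end Action

/-! ### Fixed points of Möbius transformations. -/

section Geometry

open OnePoint

theorem moebius_eq_one {f : Moebius} (h : ∀ x, (f : Equiv.Perm (OnePoint ℂ)) x = x) : f = 1 :=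
  Subtype.ext (Equiv.ext h)

theorem exists_matrix (f : Moebius) :
    ∃ g : GL (Fin 2) ℂ, ∀ x, (f : Equiv.Perm (OnePoint ℂ)) x = g • x := by
  obtain ⟨f, g, rfl⟩ := f
  exact ⟨g, fun _ => rfl⟩

theorem exists_affine {f : Moebius} (hf : (f : Equiv.Perm (OnePoint ℂ)) ∞ = ∞) :
    ∃ a b : ℂ, a ≠ 0 ∧
      ∀ z : ℂ, (f : Equiv.Perm (OnePoint ℂ)) (z : OnePoint ℂ) = ((a * z + b : ℂ) : OnePoint ℂ) := by
  obtain ⟨g, hg⟩ := exists_matrix f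
  rw [hg, smul_infty_eq_self_iff] at hf
  have hdet := g.det_ne_zero
  rw [Matrix.det_fin_two, hf, mul_zero, sub_zero] at hdet
  have h0 : g 0 0 ≠ 0 := left_ne_zero_of_mul hdet
  have h1 : g 1 1 ≠ 0 := right_ne_zero_of_mul hdet
  refine ⟨g 0 0 / g 1 1, g 0 1 / g 1 1, div_ne_zero h0 h1, fun z => ?_⟩
  rw [hg, smul_some_eq_ite, hf, zero_mul, zero_add, if_neg h1]
  congr 1
  field_simp

/-- Used to conjugate a fixed point to ∞, where the transformation becomes affine; for finite `c`
the map is `z ↦ 1 / (z - c)`. -/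
theorem exists_map_infty (x : OnePoint ℂ) :
    ∃ h : Moebius, (h : Equiv.Perm (OnePoint ℂ)) x = ∞ := by
  induction x using OnePoint.rec with
  | infty => exact ⟨1, rfl⟩
  | coe c =>
    let g : GL (Fin 2) ℂ :=
      Matrix.GeneralLinearGroup.mkOfDetNeZero !![0, 1; 1, -c] (by simp)
    refine ⟨⟨MulAction.toPermHom (GL (Fin 2) ℂ) (OnePoint ℂ) g, ⟨g, rfl⟩⟩, ?_⟩
    change g • (c : OnePoint ℂ) = ∞
    simp [g, smul_some_eq_ite, Matrix.GeneralLinearGroup.mkOfDetNeZero]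

theorem exists_fixed (f : Moebius) : ∃ x, (f : Equiv.Perm (OnePoint ℂ)) x = x := by
  obtain ⟨g, hg⟩ := exists_matrix f
  by_cases hc : g 1 0 = 0
  · exact ⟨∞, by rw [hg, smul_infty_eq_self_iff, hc]⟩
  · have hdeg : g.fixpointPolynomial.degree ≠ 0 := by
      have : g.fixpointPolynomial.degree = 2 := by
        have := Polynomial.degree_quadratic (b := g 1 1 - g 0 0) (c := - g 0 1) hc
        rw [← this, Matrix.GeneralLinearGroup.fixpointPolynomial]
        congr 1
        simp [sub_eq_add_neg]
      rw [this]; decide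
    obtain ⟨z, hz⟩ := IsAlgClosed.exists_root _ hdeg
    refine ⟨z, ?_⟩
    rw [hg, ← Matrix.GeneralLinearGroup.fixpointPolynomial_aeval_eq_zero_iff]
    simpa [Polynomial.IsRoot.def] using hz

theorem eq_one_of_affine {f : Moebius} (hf : (f : Equiv.Perm (OnePoint ℂ)) ∞ = ∞)
    (h : ∀ z : ℂ, (f : Equiv.Perm (OnePoint ℂ)) (z : OnePoint ℂ) = (z : OnePoint ℂ)) : f = 1 := by
  refine moebius_eq_one fun x => ?_
  induction x using OnePoint.rec with
  | infty => exact hf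
  | coe z => exact h z

theorem pow_translation {f : Moebius} {b : ℂ}
    (h : ∀ z : ℂ, (f : Equiv.Perm (OnePoint ℂ)) (z : OnePoint ℂ) = ((z + b : ℂ) : OnePoint ℂ))
    (k : ℕ) (z : ℂ) :
    ((f ^ k : Moebius) : Equiv.Perm (OnePoint ℂ)) (z : OnePoint ℂ) =
      ((z + k * b : ℂ) : OnePoint ℂ) := by
  induction k with
  | zero => simp
  | succ k ih =>
    rw [pow_succ']
    change (f : Equiv.Perm (OnePoint ℂ)) (((f ^ k : Moebius) : Equiv.Perm (OnePoint ℂ)) z) = _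
    rw [ih, h]
    congr 1
    push_cast
    ring

theorem eq_one_of_translation {f : Moebius} (hfin : IsOfFinOrder f)
    (hf : (f : Equiv.Perm (OnePoint ℂ)) ∞ = ∞) {b : ℂ}
    (h : ∀ z : ℂ, (f : Equiv.Perm (OnePoint ℂ)) (z : OnePoint ℂ) = ((z + b : ℂ) : OnePoint ℂ)) :
    f = 1 := by
  obtain ⟨k, hk, hk1⟩ := hfin.exists_pow_eq_one
  have h1 := pow_translation h k 0
  rw [hk1] at h1
  have h2 : (0 : ℂ) = 0 + k * b := OnePoint.coe_injective h1
  have hb : b = 0 := by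
    have : (k : ℂ) ≠ 0 := Nat.cast_ne_zero.2 hk.ne'
    simpa [this] using h2.symm
  refine eq_one_of_affine hf fun z => ?_
  rw [h, hb, add_zero]

/-- Conjugation by a map sending `x` to `∞`. -/
theorem conj_apply (h f : Moebius) (x : OnePoint ℂ) :
    ((h * f * h⁻¹ : Moebius) : Equiv.Perm (OnePoint ℂ)) ((h : Equiv.Perm (OnePoint ℂ)) x) =
      (h : Equiv.Perm (OnePoint ℂ)) ((f : Equiv.Perm (OnePoint ℂ)) x) := by
  simp

theorem eq_one_of_three_fixed {f : Moebius} {x y z : OnePoint ℂ} (hxy : x ≠ y) (hxz : x ≠ z)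
    (hyz : y ≠ z) (hx : (f : Equiv.Perm (OnePoint ℂ)) x = x)
    (hy : (f : Equiv.Perm (OnePoint ℂ)) y = y) (hz : (f : Equiv.Perm (OnePoint ℂ)) z = z) :
    f = 1 := by
  obtain ⟨h, hh⟩ := exists_map_infty x
  have key : h * f * h⁻¹ = 1 := by
    have hfx := conj_apply h f x
    rw [hx, hh] at hfx
    obtain ⟨a, b, -, hab⟩ := exists_affine hfx
    have hne : ∀ w, x ≠ w → ∃ c : ℂ, (c : OnePoint ℂ) = (h : Equiv.Perm (OnePoint ℂ)) w := by
      intro w hw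
      rw [← OnePoint.ne_infty_iff_exists, ← hh]
      exact fun e => hw ((h : Equiv.Perm (OnePoint ℂ)).injective e).symm
    obtain ⟨c, hc⟩ := hne y hxy
    obtain ⟨d, hd⟩ := hne z hxz
    have hcd : c ≠ d := by
      rintro rfl
      exact hyz ((h : Equiv.Perm (OnePoint ℂ)).injective (hc.symm.trans hd))
    have h1 := conj_apply h f y
    rw [hy, ← hc, hab] at h1
    have h2 := conj_apply h f z
    rw [hz, ← hd, hab] at h2
    have h1 : a * c + b = c := OnePoint.coe_injective h1
    have h2 : a * d + b = d := OnePoint.coe_injective h2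
    have h3 : (a - 1) * (c - d) = 0 := by linear_combination h1 - h2
    have ha : a = 1 := by
      rcases mul_eq_zero.1 h3 with h | h
      · exact sub_eq_zero.1 h
      · exact absurd (sub_eq_zero.1 h) hcd
    have hb : b = 0 := by rw [ha] at h1; linear_combination h1
    refine eq_one_of_affine hfx fun w => ?_
    rw [hab, ha, hb, one_mul, add_zero]
  simpa using key

/-- Finite order excludes nontrivial translations, so after moving `x` to ∞ the affine map is the
identity or has multiplier `a ≠ 1` and fixes `b / (1 - a)`. -/
theorem exists_second_fixed {f : Moebius} (hfin : IsOfFinOrder f) {x : OnePoint ℂ}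
    (hx : (f : Equiv.Perm (OnePoint ℂ)) x = x) :
    ∃ y, y ≠ x ∧ (f : Equiv.Perm (OnePoint ℂ)) y = y := by
  obtain ⟨h, hh⟩ := exists_map_infty x
  have hfx := conj_apply h f x
  rw [hx, hh] at hfx
  obtain ⟨a, b, -, hab⟩ := exists_affine hfx
  have hfin' : IsOfFinOrder (h * f * h⁻¹) := by
    rw [isOfFinOrder_iff_pow_eq_one] at hfin ⊢
    obtain ⟨k, hk, hk1⟩ := hfin
    exact ⟨k, hk, by rw [conj_pow, hk1]; simp⟩
  obtain ⟨c, hc⟩ : ∃ c : ℂ, a * c + b = c := by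
    by_cases ha : a = 1
    · subst ha
      have h1 := eq_one_of_translation hfin' hfx (b := b) (fun z => by rw [hab, one_mul])
      refine ⟨0, ?_⟩
      have h2 := hab 0
      rw [h1] at h2
      exact (OnePoint.coe_injective h2).symm
    · have : 1 - a ≠ 0 := sub_ne_zero.2 (Ne.symm ha)
      refine ⟨b / (1 - a), ?_⟩
      field_simp
      ring
  refine ⟨(h : Equiv.Perm (OnePoint ℂ)).symm c, ?_, ?_⟩
  · intro e
    rw [Equiv.symm_apply_eq, hh] at e
    exact OnePoint.coe_ne_infty c e
  · have h1 := conj_apply h f ((h : Equiv.Perm (OnePoint ℂ)).symm c)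
    rw [Equiv.apply_symm_apply, hab, hc] at h1
    rw [Equiv.eq_symm_apply]
    exact h1.symm

theorem ncard_fixed {f : Moebius} (hfin : IsOfFinOrder f) (h1 : f ≠ 1) :
    {x | (f : Equiv.Perm (OnePoint ℂ)) x = x}.ncard = 2 := by
  obtain ⟨x, hx⟩ := exists_fixed f
  obtain ⟨y, hyx, hy⟩ := exists_second_fixed hfin hx
  have : {x | (f : Equiv.Perm (OnePoint ℂ)) x = x} = {x, y} := by
    ext z
    constructor
    · intro hz
      by_contra hn
      simp only [Set.mem_insert_iff, Set.mem_singleton_iff, not_or] at hn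
      exact h1 (eq_one_of_three_fixed hyx.symm (Ne.symm hn.1) (Ne.symm hn.2) hx hy hz)
    · rintro (rfl | rfl)
      exacts [hx, hy]
  rw [this, Set.ncard_pair hyx.symm]

/-- A finite group of Möbius transformations with a common fixed point is cyclic. -/
theorem isCyclic_of_fixed {S : Type*} [Group S] [Finite S] (φ : S →* Moebius)
    (hφ : Function.Injective φ) (x : OnePoint ℂ)
    (hx : ∀ s, (φ s : Equiv.Perm (OnePoint ℂ)) x = x) : IsCyclic S := by
  obtain ⟨h, hh⟩ := exists_map_infty x
  let ψ : S →* Moebius := (MulAut.conj h).toMonoidHom.comp φ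
  have hψ : Function.Injective ψ := (MulAut.conj h).injective.comp hφ
  have hinf : ∀ s, (ψ s : Equiv.Perm (OnePoint ℂ)) ∞ = ∞ := by
    intro s
    have := conj_apply h (φ s) x
    rw [hx, hh] at this
    exact this
  choose a b ha hab using fun s => exists_affine (hinf s)
  have hone : a 1 = 1 := by
    have h0 := hab 1 0
    have h1 := hab 1 1
    rw [map_one] at h0 h1
    have h0 : (0 : ℂ) = a 1 * 0 + b 1 := OnePoint.coe_injective h0
    have h1 : (1 : ℂ) = a 1 * 1 + b 1 := OnePoint.coe_injective h1
    linear_combination h0 - h1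
  have hmul : ∀ s t, a (s * t) = a s * a t := by
    intro s t
    have key : ∀ z : ℂ, a (s * t) * z + b (s * t) = a s * (a t * z + b t) + b s := by
      intro z
      apply OnePoint.coe_injective
      rw [← hab, ← hab, ← hab, map_mul]
      rfl
    linear_combination key 1 - key 0
  -- The kernel of the multiplier consists of translations of finite order, hence is trivial; a
  -- finite group embedded multiplicatively in a field is cyclic.
  let χ : S →* ℂ := { toFun := a, map_one' := hone, map_mul' := hmul }
  refine isCyclic_of_injective_ringHom χ ((injective_iff_map_eq_one χ).2 fun s hs => ?_)
  have hs : a s = 1 := hs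
  apply hψ
  rw [map_one]
  refine eq_one_of_translation (ψ.isOfFinOrder (isOfFinOrder_of_finite s)) (hinf s) (b := b s) ?_
  intro z
  rw [hab, hs, one_mul]

/-- An element is determined by its restriction to `α`, which contains three points. -/
theorem stab_finite {α : Set (OnePoint ℂ)} (hfin : α.Finite) (hcard : 3 ≤ α.ncard) :
    Finite (stab α) := by
  have : Finite α := hfin
  obtain ⟨x, y, z, hx, hy, hz, hxy, hxz, hyz⟩ := (Set.two_lt_ncard_iff hfin).1 hcard
  have himg : ∀ f : stab α, ∀ u ∈ α, (f.1 : Equiv.Perm (OnePoint ℂ)) u ∈ α := fun f u hu =>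
    ((mem_stab_iff α f.1).1 f.2).subset ⟨u, hu, rfl⟩
  refine Finite.of_injective (fun f : stab α => fun u : α =>
    (⟨(f.1 : Equiv.Perm (OnePoint ℂ)) u, himg f u u.2⟩ : α)) ?_
  intro f g hfg
  have hp : ∀ u ∈ α, ((g.1⁻¹ * f.1 : Moebius) : Equiv.Perm (OnePoint ℂ)) u = u := by
    intro u hu
    have := congrArg Subtype.val (congrFun hfg ⟨u, hu⟩)
    change (g.1 : Equiv.Perm (OnePoint ℂ)).symm _ = u
    rw [Equiv.symm_apply_eq]
    exact this
  have := eq_one_of_three_fixed hxy hxz hyz (hp x hx) (hp y hy) (hp z hz)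
  exact Subtype.ext (inv_mul_eq_one.1 this).symm

end Geometry

/-! ### The action on poles, unions of orbits and the cyclic case. -/

section Stabilizer

open OnePoint MulAction

/-- The points fixed by some nontrivial element of `G`. -/
def poles (G : Subgroup Moebius) : Set (OnePoint ℂ) :=
  {x | ∃ g ∈ G, g ≠ 1 ∧ (g : Equiv.Perm (OnePoint ℂ)) x = x}

theorem isOfFinOrder_coe {G : Subgroup Moebius} [Finite G] (g : G) : IsOfFinOrder (g : Moebius) :=
  G.subtype.isOfFinOrder (isOfFinOrder_of_finite g)

theorem poles_finite (G : Subgroup Moebius) [Finite G] : (poles G).Finite := by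
  have : poles G ⊆ ⋃ g : {g : G // g ≠ 1}, {x | (g.1.1 : Equiv.Perm (OnePoint ℂ)) x = x} := by
    rintro x ⟨g, hg, hg1, hx⟩
    exact Set.mem_iUnion.2 ⟨⟨⟨g, hg⟩, fun h => hg1 (congrArg Subtype.val h)⟩, hx⟩
  refine (Set.finite_iUnion fun g => ?_).subset this
  refine Set.finite_of_ncard_ne_zero ?_
  rw [ncard_fixed (isOfFinOrder_coe g.1)
    (fun h => g.2 (Subtype.ext h))]
  norm_num

theorem apply_mem_poles {G : Subgroup Moebius} {g : Moebius} (hg : g ∈ G) {x : OnePoint ℂ}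
    (hx : x ∈ poles G) : (g : Equiv.Perm (OnePoint ℂ)) x ∈ poles G := by
  obtain ⟨f, hf, hf1, hfx⟩ := hx
  refine ⟨g * f * g⁻¹, mul_mem (mul_mem hg hf) (inv_mem hg), fun h => hf1 (conj_eq_one_iff.1 h), ?_⟩
  rw [conj_apply, hfx]

instance polesMulAction (G : Subgroup Moebius) : MulAction G (poles G) where
  smul g x := ⟨(g.1 : Equiv.Perm (OnePoint ℂ)) x.1, apply_mem_poles g.2 x.2⟩
  one_smul _ := rfl
  mul_smul _ _ _ := rfl

/-- The classification of the finite groups of Möbius transformations. -/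
theorem isCyclic_or_isPolyhedralOrDihedral (G : Subgroup Moebius) [Finite G]
    (hG : 2 ≤ Nat.card G) : IsCyclic G ∨ IsPolyhedralOrDihedral G := by
  have := (poles_finite G).to_subtype
  refine classification_of_action (X := poles G) hG ?_ ?_ ?_
  · intro g hg
    have hg1 : g.1 ≠ 1 := fun h => hg (Subtype.ext h)
    rw [← ncard_fixed (isOfFinOrder_coe g) hg1,
      ← Nat.card_coe_set_eq]
    exact Nat.card_congr
      { toFun := fun x => ⟨x.1.1, congrArg Subtype.val x.2⟩
        invFun := fun x => ⟨⟨x.1, g.1, g.2, hg1, x.2⟩, Subtype.ext x.2⟩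
        left_inv := fun _ => rfl
        right_inv := fun _ => rfl }
  · rintro ⟨x, g, hg, hg1, hx⟩ h
    have : (⟨g, hg⟩ : G) ∈ (⊥ : Subgroup G) := h ▸ (Subtype.ext hx : _ • _ = _)
    exact hg1 (congrArg Subtype.val (Subgroup.mem_bot.1 this))
  · intro x
    refine isCyclic_of_fixed (G.subtype.comp (stabilizer G x).subtype)
      (G.subtype_injective.comp (stabilizer G x).subtype_injective) x.1 fun s => ?_
    exact congrArg Subtype.val s.2

theorem not_isPolyhedralOrDihedral_of_isCyclic (H : Subgroup Moebius) [hc : IsCyclic H] :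
    ¬ IsPolyhedralOrDihedral H := by
  have hcomm : ∀ a b : H, a * b = b * a := (IsCyclic.commGroup (α := H)).mul_comm
  have hperm : ∀ {K : Type} [Group K], (∃ a b : K, a * b ≠ b * a) → ¬ Nonempty (H ≃* K) := by
    rintro K _ ⟨a, b, hab⟩ ⟨e⟩
    apply hab
    apply e.symm.injective
    rw [map_mul, map_mul, hcomm]
  rintro (h | h | h | ⟨m, hm, ⟨e⟩⟩)
  · exact hperm (by decide) h
  · exact hperm (by decide) h
  · exact hperm (by decide) h
  -- Non-commutativity would not suffice here, as `D_2` is abelian.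
  · exact DihedralGroup.not_isCyclic (by omega) (isCyclic_of_surjective e e.surjective)

theorem mem_stab_of_forall_mem {α : Set (OnePoint ℂ)} {H : Subgroup Moebius}
    (h : ∀ f ∈ H, ∀ x ∈ α, (f : Equiv.Perm (OnePoint ℂ)) x ∈ α) : H ≤ stab α := by
  intro f hf
  rw [mem_stab_iff]
  refine Set.Subset.antisymm (Set.image_subset_iff.2 fun x hx => h f hf x hx) fun x hx => ?_
  exact ⟨(f⁻¹ : Moebius).1 x, h _ (inv_mem hf) x hx, Equiv.apply_symm_apply f.1 x⟩

theorem apply_mem_of_mem_stab {α : Set (OnePoint ℂ)} {f : Moebius} (hf : f ∈ stab α)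
    {x : OnePoint ℂ} (hx : x ∈ α) : (f : Equiv.Perm (OnePoint ℂ)) x ∈ α :=
  ((mem_stab_iff α f).1 hf).subset ⟨x, hx, rfl⟩

theorem isUnionOf_orbits_iff (H : Subgroup Moebius) (α : Set (OnePoint ℂ)) :
    IsUnionOf (orbits H) α ↔ H ≤ stab α := by
  constructor
  · rintro ⟨T, hT, rfl⟩
    refine mem_stab_of_forall_mem ?_
    rintro f hf x ⟨C, hC, hx⟩
    refine ⟨C, hC, ?_⟩
    obtain ⟨y, rfl⟩ := hT hC
    obtain ⟨g, hg, rfl⟩ := hx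
    exact ⟨f * g, mul_mem hf hg, rfl⟩
  · intro h
    refine ⟨{C | C ∈ orbits H ∧ C ⊆ α}, fun C hC => hC.1, ?_⟩
    refine Set.Subset.antisymm (fun x hx => ?_) (Set.sUnion_subset fun C hC => hC.2)
    refine ⟨_, ⟨⟨x, rfl⟩, ?_⟩, ⟨1, one_mem H, rfl⟩⟩
    rintro _ ⟨f, hf, rfl⟩
    exact apply_mem_of_mem_stab (h hf) hx

/-! ### Rotations about 0 and the groups they generate. -/

theorem zeta_zpow (n : ℕ) (k : ℤ) :
    zeta n ^ k = Complex.exp (2 * Real.pi * Complex.I * k / n) := by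
  rw [zeta, ← Complex.exp_int_mul]
  congr 1
  ring

theorem rotation_zpow_apply_coe (n : ℕ) (k : ℤ) (z : ℂ) :
    ((rotation n ^ k : Moebius) : Equiv.Perm (OnePoint ℂ)) (z : OnePoint ℂ) =
      ((zeta n ^ k * z : ℂ) : OnePoint ℂ) := by
  induction k generalizing z with
  | zero => simp
  | succ k ih =>
    rw [zpow_add_one, zpow_add_one₀ (zeta_ne_zero n)]
    change ((rotation n ^ (k : ℤ) : Moebius) : Equiv.Perm (OnePoint ℂ))
      ((rotation n : Equiv.Perm (OnePoint ℂ)) z) = _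
    rw [rotation_apply_coe, ih, mul_assoc]
  | pred k ih =>
    rw [zpow_sub_one, zpow_sub_one₀ (zeta_ne_zero n)]
    change ((rotation n ^ (-k : ℤ) : Moebius) : Equiv.Perm (OnePoint ℂ))
      ((rotation n : Equiv.Perm (OnePoint ℂ)).symm z) = _
    have : (rotation n : Equiv.Perm (OnePoint ℂ)).symm z =
        (((zeta n)⁻¹ * z : ℂ) : OnePoint ℂ) := by
      rw [Equiv.symm_apply_eq, rotation_apply_coe, mul_inv_cancel_left₀ (zeta_ne_zero n)]
    rw [this, ih, mul_assoc]

theorem rotation_zpow_apply_infty (n : ℕ) (k : ℤ) :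
    ((rotation n ^ k : Moebius) : Equiv.Perm (OnePoint ℂ)) ∞ = ∞ := by
  have h : rotation n ∈ stab {∞} := by
    rw [mem_stab_iff, Set.image_singleton, rotation_apply_infty]
  have := apply_mem_of_mem_stab (zpow_mem h k) (Set.mem_singleton ∞)
  exact this

theorem mem_circleOrbit_iff (n : ℕ) (z : ℂ) (w : OnePoint ℂ) :
    w ∈ circleOrbit n z ↔
      ∃ k : ℤ, w = ((rotation n ^ k : Moebius) : Equiv.Perm (OnePoint ℂ)) (z : OnePoint ℂ) := by
  simp only [rotation_zpow_apply_coe, zeta_zpow]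
  rfl

theorem isUnionOf_cyclicPieces_iff (n : ℕ) (α : Set (OnePoint ℂ)) :
    IsUnionOf (cyclicPieces n) α ↔ rotation n ∈ stab α := by
  rw [← Subgroup.zpowers_le]
  constructor
  · rintro ⟨T, hT, rfl⟩
    refine mem_stab_of_forall_mem ?_
    rintro f hf x ⟨C, hC, hx⟩
    obtain ⟨k, rfl⟩ := Subgroup.mem_zpowers_iff.1 hf
    refine ⟨C, hC, ?_⟩
    rcases hT hC with (rfl | rfl) | ⟨z, -, rfl⟩
    · rw [Set.mem_singleton_iff.1 hx, rotation_zpow_apply_infty]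
      rfl
    · rw [Set.mem_singleton_iff.1 hx, rotation_zpow_apply_coe, mul_zero]
      rfl
    · obtain ⟨l, rfl⟩ := (mem_circleOrbit_iff n z x).1 hx
      refine (mem_circleOrbit_iff n z _).2 ⟨k + l, ?_⟩
      rw [zpow_add]
      rfl
  · intro h
    refine ⟨{C | C ∈ cyclicPieces n ∧ C ⊆ α}, fun C hC => hC.1, ?_⟩
    refine Set.Subset.antisymm (fun x hx => ?_) (Set.sUnion_subset fun C hC => hC.2)
    induction x using OnePoint.rec with
    | infty => exact ⟨{∞}, ⟨.inl (.inl rfl), Set.singleton_subset_iff.2 hx⟩, rfl⟩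
    | coe z =>
      by_cases hz : z = 0
      · subst hz
        exact ⟨{((0 : ℂ) : OnePoint ℂ)}, ⟨.inl (.inr rfl), Set.singleton_subset_iff.2 hx⟩, rfl⟩
      · refine ⟨circleOrbit n z, ⟨.inr ⟨z, hz, rfl⟩, fun w hw => ?_⟩,
          (mem_circleOrbit_iff n z _).2 ⟨0, by simp⟩⟩
        obtain ⟨k, rfl⟩ := (mem_circleOrbit_iff n z w).1 hw
        exact apply_mem_of_mem_stab (h (Subgroup.mem_zpowers_iff.2 ⟨k, rfl⟩)) hx

theorem isPrimitiveRoot_zeta {n : ℕ} (hn : n ≠ 0) : IsPrimitiveRoot (zeta n) n :=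
  Complex.isPrimitiveRoot_exp n hn

theorem rotation_zpow_eq_one_iff (n : ℕ) (k : ℤ) : rotation n ^ k = 1 ↔ zeta n ^ k = 1 := by
  constructor
  · intro h
    have := rotation_zpow_apply_coe n k 1
    rw [h, mul_one] at this
    exact (OnePoint.coe_injective this).symm
  · intro h
    refine eq_one_of_affine (rotation_zpow_apply_infty n k) fun z => ?_
    rw [rotation_zpow_apply_coe, h, one_mul]

theorem orderOf_rotation {n : ℕ} (hn : n ≠ 0) : orderOf (rotation n) = n := by
  rw [(isPrimitiveRoot_zeta hn).eq_orderOf, orderOf_eq_orderOf_iff]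
  intro k
  have := rotation_zpow_eq_one_iff n k
  rw [zpow_natCast, zpow_natCast] at this
  rw [← (isPrimitiveRoot_zeta hn).eq_orderOf]
  exact this

/-- A finite order Möbius transformation fixing `0` and `∞` generates the same group as a
rotation. -/
theorem mem_zpowers_rotation {g : Moebius} (hg : IsOfFinOrder g)
    (hinf : (g : Equiv.Perm (OnePoint ℂ)) ∞ = ∞)
    (h0 : (g : Equiv.Perm (OnePoint ℂ)) ((0 : ℂ) : OnePoint ℂ) = ((0 : ℂ) : OnePoint ℂ)) :
    g ∈ Subgroup.zpowers (rotation (orderOf g)) := by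
  obtain ⟨a, b, ha, hab⟩ := exists_affine hinf
  have hb : b = 0 := by
    rw [hab, mul_zero, zero_add] at h0
    exact OnePoint.coe_injective h0
  subst hb
  have hpow : ∀ k : ℕ, ((g ^ k : Moebius) : Equiv.Perm (OnePoint ℂ)) ((1 : ℂ) : OnePoint ℂ) =
      ((a ^ k : ℂ) : OnePoint ℂ) := by
    intro k
    induction k with
    | zero => simp
    | succ k ih =>
      rw [pow_succ']
      change (g : Equiv.Perm (OnePoint ℂ)) (((g ^ k : Moebius) : Equiv.Perm (OnePoint ℂ)) _) = _
      rw [ih, hab, add_zero, pow_succ']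
  have hak : a ^ orderOf g = 1 := by
    have := hpow (orderOf g)
    rw [pow_orderOf_eq_one] at this
    exact (OnePoint.coe_injective this).symm
  have : NeZero (orderOf g) := ⟨hg.orderOf_pos.ne'⟩
  -- The multiplier of `g` is a root of unity of order dividing `orderOf g`.
  obtain ⟨k, -, hk⟩ := (isPrimitiveRoot_zeta hg.orderOf_pos.ne').eq_pow_of_pow_eq_one hak
  refine Subgroup.mem_zpowers_iff.2 ⟨k, ?_⟩
  symm
  refine Subtype.ext (Equiv.ext fun x => ?_)
  induction x using OnePoint.rec with
  | infty => rw [hinf, rotation_zpow_apply_infty]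
  | coe z => rw [hab, rotation_zpow_apply_coe, zpow_natCast, hk, add_zero]

theorem stab_eq_cyclicGroup {n : ℕ} (hn : 2 ≤ n) {α : Set (OnePoint ℂ)} [Finite (stab α)]
    (hcyc : IsCyclic (stab α)) (hrot : rotation n ∈ stab α)
    (hmax : ∀ p : ℕ, 2 ≤ p → rotation (p * n) ∉ stab α) : stab α = cyclicGroup n := by
  obtain ⟨⟨g, hg⟩, hgen⟩ := hcyc.exists_generator
  have hz : stab α = Subgroup.zpowers g := by
    refine le_antisymm (fun f hf => ?_) (Subgroup.zpowers_le.2 hg)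
    obtain ⟨k, hk⟩ := Subgroup.mem_zpowers_iff.1 (hgen ⟨f, hf⟩)
    exact Subgroup.mem_zpowers_iff.2 ⟨k, congrArg Subtype.val hk⟩
  have hgfin : IsOfFinOrder g := isOfFinOrder_coe (⟨g, hg⟩ : stab α)
  have hord : n ∣ orderOf g := by
    rw [← orderOf_rotation (by omega : n ≠ 0), ← Nat.card_zpowers g, ← hz]
    exact (stab α).orderOf_dvd_natCard hrot
  have hrot1 : rotation n ≠ 1 := by
    intro h
    have := orderOf_rotation (by omega : n ≠ 0)
    rw [h, orderOf_one] at this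
    omega
  have hg1 : g ≠ 1 := by
    rintro rfl
    rw [hz, Subgroup.zpowers_one_eq_bot] at hrot
    exact hrot1 hrot
  -- The rotation is a power of `g`, so it fixes what `g` fixes; both fixed sets have two points.
  have hfix : {x | (g : Equiv.Perm (OnePoint ℂ)) x = x} =
      {x | (rotation n : Equiv.Perm (OnePoint ℂ)) x = x} := by
    have hrfin : IsOfFinOrder (rotation n) :=
      isOfFinOrder_coe (⟨_, hrot⟩ : stab α)
    have h2 := ncard_fixed hrfin hrot1
    refine Set.eq_of_subset_of_ncard_le (fun x hx => ?_) (by rw [h2, ncard_fixed hgfin hg1])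
      (Set.finite_of_ncard_ne_zero (by omega))
    obtain ⟨k, hk⟩ := Subgroup.mem_zpowers_iff.1 (hz ▸ hrot)
    have hmem : g ∈ stab {x} := by
      rw [mem_stab_iff, Set.image_singleton, hx]
    have := apply_mem_of_mem_stab (zpow_mem hmem k) (Set.mem_singleton x)
    rw [hk] at this
    exact this
  have hinf : (g : Equiv.Perm (OnePoint ℂ)) ∞ = ∞ := hfix.symm.subset (rotation_apply_infty n)
  have h0 : (g : Equiv.Perm (OnePoint ℂ)) ((0 : ℂ) : OnePoint ℂ) = ((0 : ℂ) : OnePoint ℂ) := by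
    refine hfix.symm.subset ?_
    change (rotation n : Equiv.Perm (OnePoint ℂ)) _ = _
    rw [rotation_apply_coe, mul_zero]
  have hle := Subgroup.zpowers_le.2 (mem_zpowers_rotation hgfin hinf h0)
  have hpos := hgfin.orderOf_pos
  have heq : stab α = cyclicGroup (orderOf g) := by
    rw [hz, cyclicGroup]
    have hc : Nat.card (Subgroup.zpowers (rotation (orderOf g))) = orderOf g := by
      rw [Nat.card_zpowers, orderOf_rotation hpos.ne']
    have : Finite (Subgroup.zpowers (rotation (orderOf g))) :=
      (Nat.card_pos_iff.1 (by rw [hc]; exact hpos)).2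
    exact Subgroup.eq_of_le_of_card_ge hle (by rw [hc, Nat.card_zpowers])
  -- With `orderOf g = n * p`, the group contains `rotation (p * n)`, so `hmax` rules out `p ≥ 2`.
  obtain ⟨p, hp⟩ := hord
  have hp1 : p = 1 := by
    by_contra hp1
    have hp0 : p ≠ 0 := by
      rintro rfl
      omega
    refine hmax p (by omega) ?_
    rw [heq, hp, mul_comm n p]
    exact Subgroup.mem_zpowers _
  rw [heq, hp, hp1, mul_one]

end Stabilizer

end SphereStabilizer

theorem mainTheorem10 (n : ℕ) (hn : 2 ≤ n) (α : Set (OnePoint ℂ)) (hfin : α.Finite)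
    (hcard : 3 ≤ α.ncard) :
    (SphereStabilizer.stab α = SphereStabilizer.cyclicGroup n ↔
      SphereStabilizer.IsUnionOf (SphereStabilizer.cyclicPieces n) α ∧
      (∀ p : ℕ, 2 ≤ p →
        ¬ SphereStabilizer.IsUnionOf (SphereStabilizer.cyclicPieces (p * n)) α) ∧
      ¬ SphereStabilizer.IsPolyhedralOrDihedral (SphereStabilizer.stab α)) ∧
    (SphereStabilizer.stab α = SphereStabilizer.cyclicGroup n ↔
      SphereStabilizer.IsUnionOf (SphereStabilizer.cyclicPieces n) α ∧
      (∀ p : ℕ, 2 ≤ p →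
        ¬ SphereStabilizer.IsUnionOf (SphereStabilizer.cyclicPieces (p * n)) α) ∧
      ¬ ∃ H : Subgroup SphereStabilizer.Moebius,
        SphereStabilizer.IsPolyhedralOrDihedral H ∧
        SphereStabilizer.IsUnionOf (SphereStabilizer.orbits H) α) := by
  have := SphereStabilizer.stab_finite hfin hcard
  simp only [SphereStabilizer.isUnionOf_cyclicPieces_iff, SphereStabilizer.isUnionOf_orbits_iff]
  -- This serves both readings of condition 3: the orbit version yields the other by taking `H =
  -- stab α`.
  have hback : SphereStabilizer.rotation n ∈ SphereStabilizer.stab α →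
      (∀ p : ℕ, 2 ≤ p → SphereStabilizer.rotation (p * n) ∉ SphereStabilizer.stab α) →
      ¬ SphereStabilizer.IsPolyhedralOrDihedral (SphereStabilizer.stab α) →
      SphereStabilizer.stab α = SphereStabilizer.cyclicGroup n := by
    intro h1 h2 h3
    have hdvd := (SphereStabilizer.stab α).orderOf_dvd_natCard h1
    rw [SphereStabilizer.orderOf_rotation (by omega)] at hdvd
    have h4 := Nat.le_of_dvd Nat.card_pos hdvd
    have h5 := (SphereStabilizer.isCyclic_or_isPolyhedralOrDihedral _ (by omega)).resolve_right h3
    exact SphereStabilizer.stab_eq_cyclicGroup hn h5 h1 h2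
  have hforth : SphereStabilizer.stab α = SphereStabilizer.cyclicGroup n →
      SphereStabilizer.rotation n ∈ SphereStabilizer.stab α ∧
      (∀ p : ℕ, 2 ≤ p → SphereStabilizer.rotation (p * n) ∉ SphereStabilizer.stab α) ∧
      ∀ H ≤ SphereStabilizer.stab α, ¬ SphereStabilizer.IsPolyhedralOrDihedral H := by
    intro h
    refine ⟨h ▸ Subgroup.mem_zpowers _, fun p hp hmem => ?_, fun H hH => ?_⟩
    -- Membership would make `p * n` divide the group order `n`.
    · have h1 := (SphereStabilizer.stab α).orderOf_dvd_natCard hmem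
      have hpn : 2 * n ≤ p * n := Nat.mul_le_mul_right n hp
      rw [SphereStabilizer.orderOf_rotation (by omega), h, SphereStabilizer.cyclicGroup,
        Nat.card_zpowers, SphereStabilizer.orderOf_rotation (by omega)] at h1
      have := Nat.le_of_dvd (by omega) h1
      omega
    · have hc : IsCyclic (SphereStabilizer.stab α) := by
        rw [h, SphereStabilizer.cyclicGroup]
        infer_instance
      have : IsCyclic H :=
        isCyclic_of_injective (Subgroup.inclusion hH) (Subgroup.inclusion_injective hH)
      exact SphereStabilizer.not_isPolyhedralOrDihedral_of_isCyclic H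
  refine ⟨⟨fun h => ?_, fun h => hback h.1 h.2.1 h.2.2⟩,
    ⟨fun h => ?_, fun h => hback h.1 h.2.1 fun h' => h.2.2 ⟨_, h', le_rfl⟩⟩⟩
  · obtain ⟨h1, h2, h3⟩ := hforth h
    exact ⟨h1, h2, h3 _ le_rfl⟩
  · obtain ⟨h1, h2, h3⟩ := hforth h
    exact ⟨h1, h2, fun ⟨H, hH, hle⟩ => h3 H hle hH⟩
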